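/- Let $c_0$ be the Banach lattice of real sequences converging to $0$, with the supremum norm and the coordinatewise order. Two Banach lattices, or vector sublattices of Banach lattices, $E$ and $F$ are called order isomorphic if there is a (not necessarily linear) bijection $T:E\to F$ such that $x\ge y$ if and only if $Tx\ge Ty$ for all $x,y\in E$; they are called lattice isomorphic if there is a linear bijection $T:E\to F$ such that $T|x|=|Tx|$ for all $x\in E$. Let $E$ be a real Banach lattice. Then the following are equivalent: (a) $E$ is lattice isomorphic to $c_0$; (b) $E$ is order isomorphic to $c_0$; (c) $E$ is order isomorphic to an infinite-dimensional closed sublattice (a norm-closed linear subspace closed under the binary lattice operations, with the induced order) of $c_0$. -/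

import Mathlib

open scoped ZeroAtInfty

noncomputable section

namespace BanachLattice

/-- The space `c₀` of real null sequences with the supremum norm: the (automatically continuous)
functions on the discrete space `ℕ` that tend to zero at infinity. -/
abbrev c0 : Type := C₀(ℕ, ℝ)

/-- The coordinatewise order and lattice operations on `c₀`. -/
instance instLatticeC0 : Lattice c0 where
  le f g := ∀ n, f n ≤ g n
  le_refl _ _ := le_rfl
  le_trans _ _ _ hfg hgh n := (hfg n).trans (hgh n)
  le_antisymm _ _ hfg hgf := ZeroAtInftyContinuousMap.ext fun n => le_antisymm (hfg n) (hgf n)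
  sup f g :=
    { toFun := fun n => f n ⊔ g n
      continuous_toFun := continuous_of_discreteTopology
      zero_at_infty' := by
        simpa using (zero_at_infty f).sup_nhds (zero_at_infty g) }
  inf f g :=
    { toFun := fun n => f n ⊓ g n
      continuous_toFun := continuous_of_discreteTopology
      zero_at_infty' := by
        simpa using (zero_at_infty f).inf_nhds (zero_at_infty g) }
  le_sup_left _ _ _ := le_sup_left
  le_sup_right _ _ _ := le_sup_right
  sup_le _ _ _ hf hg n := sup_le (hf n) (hg n)
  inf_le_left _ _ _ := inf_le_left
  inf_le_right _ _ _ := inf_le_right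
  le_inf _ _ _ hf hg n := le_inf (hf n) (hg n)

/-- `E` and `F` are order isomorphic: there is a bijection `T : E → F`, not necessarily linear,
such that `x ≤ y` if and only if `T x ≤ T y`. -/
def OrderIsomorphic (E F : Type*) [LE E] [LE F] : Prop :=
  Nonempty (E ≃o F)

/-- `E` and `F` are lattice isomorphic: there is a linear bijection `T : E → F` such that
`T |x| = |T x|` for all `x`. -/
def LatticeIsomorphic (E F : Type*) [AddCommGroup E] [Module ℝ E] [Lattice E]
    [AddCommGroup F] [Module ℝ F] [Lattice F] : Prop :=
  ∃ T : E ≃ₗ[ℝ] F, ∀ x : E, T |x| = |T x|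

/-- A linear subspace `F` of a normed vector lattice is a closed sublattice if it is closed under
the lattice operations and topologically closed. -/
def IsClosedSublattice {E : Type*} [NormedAddCommGroup E] [NormedSpace ℝ E] [Lattice E]
    (F : Submodule ℝ E) : Prop :=
  IsSublattice (F : Set E) ∧ IsClosed (F : Set E)

end BanachLattice

end

/-!
A closed sublattice `F` of `c₀` is spanned by atoms. For each coordinate `k` at which `F` does not
vanish, the positive elements of `F` with value `1` at `k` have a least element
(`IsClosedSublattice.exists_isAtomAt`), and any two of these atoms are proportional or disjoint.
Choosing one normalised atom from each class gives coordinates on `F`, so an infinite-dimensional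
`F` is order isomorphic to `c₀` (`IsClosedSublattice.orderIsomorphic_c0`).

It remains to linearise an order isomorphism `T : E ≃o c₀` with `T 0 = 0`. It preserves disjointness
and chains, so for `δ > 0` the vectors `bₙ = T⁻¹ (δ eₙ)` are disjoint and `T` maps the ray spanned by
`bₙ` onto the one spanned by `eₙ` (`exists_eq_smul_unitPreimage`). For some `δ` the
finite sums of the `bₙ` are bounded in norm: otherwise unbounded finite sums at the levels
`δ = 2⁻ᵏ` would all lie below the preimage of a single null sequence
(`exists_norm_sum_unitPreimage_le`). For this `δ`, completeness of `E` makes `∑ cₙ bₙ` converge for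
each null sequence `c`. Conversely, the coefficients `tₙ` of a positive `x` tend to zero, because
`T (r x)` is a null sequence for each `r > 0`, which forces `r tₙ < 1` for all but finitely many `n`
(`exists_hasSum_unitPreimage`). Hence `c ↦ ∑ cₙ bₙ` is a linear order isomorphism from `c₀` onto `E`.
-/

noncomputable section

namespace BanachLattice

open scoped ZeroAtInfty Topology
open Filter

/-! ### The Banach lattice `c₀` -/

lemma c0_inf_apply (f g : c0) (n : ℕ) : (f ⊓ g) n = f n ⊓ g n := rfl

lemma c0_abs_apply_le_norm (f : c0) (n : ℕ) : |f n| ≤ ‖f‖ :=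
  f.toBCF.norm_coe_le_norm n

lemma c0_norm_le_iff {f : c0} {r : ℝ} (hr : 0 ≤ r) : ‖f‖ ≤ r ↔ ∀ n, |f n| ≤ r := by
  rw [← ZeroAtInftyContinuousMap.norm_toBCF_eq_norm, BoundedContinuousFunction.norm_le hr]
  rfl

instance instIsOrderedAddMonoidC0 : IsOrderedAddMonoid c0 where
  add_le_add_left _ _ h a n := add_le_add_left (h n) (a n)

instance instIsOrderedModuleC0 : IsOrderedModule ℝ c0 where
  smul_le_smul_of_nonneg_left _ hr _ _ h n := mul_le_mul_of_nonneg_left (h n) hr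
  smul_le_smul_of_nonneg_right _ hf _ _ h n := mul_le_mul_of_nonneg_right h (hf n)

instance instHasSolidNormC0 : HasSolidNorm c0 where
  solid _ g h :=
    (c0_norm_le_iff (norm_nonneg g)).2 fun n => (h n).trans (c0_abs_apply_le_norm g n)

/-- Evaluation at a coordinate, as a linear functional on `c₀`. -/
def c0Eval (n : ℕ) : c0 →ₗ[ℝ] ℝ where
  toFun f := f n
  map_add' _ _ := rfl
  map_smul' _ _ := rfl

lemma continuous_c0_apply (n : ℕ) : Continuous fun f : c0 => f n :=
  AddMonoidHomClass.continuous_of_bound (c0Eval n) 1 fun f =>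
    (c0_abs_apply_le_norm f n).trans_eq (one_mul _).symm

lemma c0_sum_apply {ι : Type*} (s : Finset ι) (f : ι → c0) (n : ℕ) :
    (∑ i ∈ s, f i) n = ∑ i ∈ s, f i n :=
  map_sum (c0Eval n) f s

/-- The null sequence given by a function tending to zero along the cofinite filter. -/
def c0Mk (f : ℕ → ℝ) (hf : Tendsto f cofinite (𝓝 0)) : c0 where
  toFun := f
  continuous_toFun := continuous_of_discreteTopology
  zero_at_infty' := by rwa [cocompact_eq_cofinite]

lemma c0_tendsto (f : c0) : Tendsto f cofinite (𝓝 0) := by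
  have h := zero_at_infty f
  rwa [cocompact_eq_cofinite] at h

/-- The `n`-th unit vector of `c₀`. -/
def c0Unit (n : ℕ) : c0 :=
  c0Mk (Pi.single n 1) <| tendsto_const_nhds.congr' <| by
    filter_upwards [(Set.finite_singleton n).compl_mem_cofinite] with m hm
    exact (Pi.single_eq_of_ne (M := fun _ => ℝ) hm 1).symm

lemma c0Unit_apply_self (n : ℕ) : c0Unit n n = 1 := Pi.single_eq_same n 1

lemma c0Unit_apply_ne {n m : ℕ} (h : m ≠ n) : c0Unit n m = 0 := Pi.single_eq_of_ne h 1

lemma c0Unit_nonneg (n : ℕ) : 0 ≤ c0Unit n := fun m => by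
  rcases eq_or_ne m n with rfl | h
  · simp [c0Unit_apply_self]
  · simp [c0Unit_apply_ne h]

lemma smul_c0Unit_le_iff {n : ℕ} {s : ℝ} {f : c0} (hf : 0 ≤ f) :
    s • c0Unit n ≤ f ↔ s ≤ f n := by
  refine ⟨fun h => ?_, fun h m => ?_⟩
  · simpa [c0Unit_apply_self] using h n
  · rcases eq_or_ne m n with rfl | hm
    · simpa [c0Unit_apply_self] using h
    · simpa [c0Unit_apply_ne hm] using hf m

/-- Unit vectors are atoms: elements disjoint from every other unit vector lie on their rays. -/
lemma eq_smul_c0Unit {n : ℕ} {f : c0} (h : ∀ m, m ≠ n → f m = 0) : f = f n • c0Unit n := by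
  ext m
  rcases eq_or_ne m n with rfl | hm
  · simp [c0Unit_apply_self]
  · simp [c0Unit_apply_ne hm, h m hm]

/-! ### Disjoint families in Banach lattices -/

section Riesz

variable {E : Type*} [AddCommGroup E] [Lattice E] [IsOrderedAddMonoid E]

lemma inf_add_eq_zero {x y z : E} (hx : 0 ≤ x) (hy : 0 ≤ y) (hz : 0 ≤ z) (hxy : x ⊓ y = 0)
    (hxz : x ⊓ z = 0) : x ⊓ (y + z) = 0 := by
  refine le_antisymm ?_ (le_inf hx (add_nonneg hy hz))
  have h : (x ⊓ y) + (x ⊓ z) = ((x + x) ⊓ (y + x)) ⊓ ((x + z) ⊓ (y + z)) := by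
    rw [add_inf, inf_add, inf_add]
  calc x ⊓ (y + z) ≤ ((x + x) ⊓ (y + x)) ⊓ ((x + z) ⊓ (y + z)) :=
        le_inf (le_inf (inf_le_left.trans (le_add_of_nonneg_left hx))
          (inf_le_left.trans (le_add_of_nonneg_left hy)))
          (le_inf (inf_le_left.trans (le_add_of_nonneg_right hz)) inf_le_right)
    _ = 0 := by rw [← h, hxy, hxz, add_zero]

lemma inf_sum_eq_zero {ι : Type*} {x : E} {b : ι → E} {s : Finset ι} (hx : 0 ≤ x)
    (hb : ∀ i ∈ s, 0 ≤ b i) (hxb : ∀ i ∈ s, x ⊓ b i = 0) : x ⊓ ∑ i ∈ s, b i = 0 := by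
  classical
  induction s using Finset.induction_on with
  | empty => simpa using hx
  | insert a s ha ih =>
    rw [Finset.sum_insert ha]
    have hb' : ∀ i ∈ s, 0 ≤ b i := fun i hi => hb i (Finset.mem_insert_of_mem hi)
    exact inf_add_eq_zero hx (hb a (Finset.mem_insert_self a s)) (Finset.sum_nonneg hb')
      (hxb a (Finset.mem_insert_self a s))
      (ih hb' fun i hi => hxb i (Finset.mem_insert_of_mem hi))

/-- The sum of a finite disjoint family of positive elements is its supremum. -/
lemma sum_le_iff_of_disjoint {ι : Type*} {b : ι → E} {s : Finset ι} (hb : ∀ i ∈ s, 0 ≤ b i)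
    (hd : (s : Set ι).Pairwise fun i j => b i ⊓ b j = 0) {y : E} (hy : 0 ≤ y) :
    ∑ i ∈ s, b i ≤ y ↔ ∀ i ∈ s, b i ≤ y := by
  classical
  induction s using Finset.induction_on with
  | empty => simpa using hy
  | insert a s ha ih =>
    have hb' : ∀ i ∈ s, 0 ≤ b i := fun i hi => hb i (Finset.mem_insert_of_mem hi)
    have h0 : b a ⊓ ∑ i ∈ s, b i = 0 :=
      inf_sum_eq_zero (hb a (Finset.mem_insert_self a s)) hb' fun i hi =>
        hd (Finset.mem_insert_self a s) (Finset.mem_insert_of_mem hi) (by rintro rfl; exact ha hi)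
    rw [Finset.sum_insert ha, ← inf_add_sup, h0, zero_add, sup_le_iff,
      ih hb' (hd.mono (by simp)), Finset.forall_mem_insert]

lemma nsmul_inf_eq_zero {x y : E} (hx : 0 ≤ x) (hy : 0 ≤ y) (h : y ⊓ x = 0) (k : ℕ) :
    y ⊓ k • x = 0 := by
  simpa using inf_sum_eq_zero (s := Finset.range k) (b := fun _ => x) hy (fun _ _ => hx)
    (fun _ _ => h)

variable [Module ℝ E] [IsOrderedModule ℝ E]

lemma inf_smul_eq_zero {x y : E} (hx : 0 ≤ x) (hy : 0 ≤ y) (h : y ⊓ x = 0) {r : ℝ} (hr : 0 ≤ r) :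
    y ⊓ r • x = 0 := by
  obtain ⟨k, hk⟩ := exists_nat_ge r
  refine le_antisymm ?_ (le_inf hy (smul_nonneg hr hx))
  rw [← nsmul_inf_eq_zero hx hy h k, ← Nat.cast_smul_eq_nsmul ℝ]
  exact inf_le_inf_left y (smul_le_smul_of_nonneg_right hk hx)

end Riesz

section Banach

variable {E : Type*} [NormedAddCommGroup E] [Lattice E] [IsOrderedAddMonoid E] [HasSolidNorm E]

lemma norm_le_norm_of_nonneg_of_le {x y : E} (hx : 0 ≤ x) (h : x ≤ y) : ‖x‖ ≤ ‖y‖ :=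
  norm_le_norm_of_abs_le_abs <| by rwa [abs_of_nonneg hx, abs_of_nonneg (hx.trans h)]

variable [NormedSpace ℝ E] [IsOrderedModule ℝ E]

/-- Coefficients of absolute value at most `r` increase the norm of a positive combination by at
most the factor `r`. -/
lemma norm_sum_smul_le {ι : Type*} {b : ι → E} (hb : ∀ i, 0 ≤ b i) {c : ι → ℝ} {r : ℝ}
    (hr : 0 ≤ r) (s : Finset ι) (hc : ∀ i ∈ s, |c i| ≤ r) :
    ‖∑ i ∈ s, c i • b i‖ ≤ r * ‖∑ i ∈ s, b i‖ := by
  have hrn : r * ‖∑ i ∈ s, b i‖ = ‖r • ∑ i ∈ s, b i‖ := by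
    rw [norm_smul, Real.norm_of_nonneg hr]
  rw [hrn]
  apply norm_le_norm_of_abs_le_abs
  rw [abs_of_nonneg (smul_nonneg hr (Finset.sum_nonneg fun i _ => hb i)), abs, sup_le_iff,
    ← Finset.sum_neg_distrib, Finset.smul_sum]
  refine ⟨Finset.sum_le_sum fun i hi => ?_, Finset.sum_le_sum fun i hi => ?_⟩
  · exact smul_le_smul_of_nonneg_right ((le_abs_self _).trans (hc i hi)) (hb i)
  · rw [← neg_smul]
    exact smul_le_smul_of_nonneg_right ((neg_le_abs _).trans (hc i hi)) (hb i)

/-- A positive family whose finite sums are bounded in norm may be summed against any null family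
of coefficients. -/
lemma summable_smul_of_norm_sum_le [CompleteSpace E] {ι : Type*} {b : ι → E} (hb : ∀ i, 0 ≤ b i)
    {M : ℝ} (hM : ∀ s : Finset ι, ‖∑ i ∈ s, b i‖ ≤ M) {c : ι → ℝ}
    (hc : Tendsto c cofinite (𝓝 0)) : Summable fun i => c i • b i := by
  have hM0 : 0 ≤ M := (norm_nonneg _).trans (hM ∅)
  rw [summable_iff_vanishing_norm]
  intro ε hε
  have hr : 0 < ε / (M + 1) := by positivity
  have hfin : {i | ¬ |c i| ≤ ε / (M + 1)}.Finite := by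
    have := hc.abs
    rw [abs_zero] at this
    exact (this.eventually_le_const hr)
  refine ⟨hfin.toFinset, fun t ht => ?_⟩
  have hle : ∀ i ∈ t, |c i| ≤ ε / (M + 1) := fun i hi => by
    by_contra h
    exact Finset.disjoint_left.1 ht hi (hfin.mem_toFinset.2 h)
  calc ‖∑ i ∈ t, c i • b i‖ ≤ ε / (M + 1) * ‖∑ i ∈ t, b i‖ := norm_sum_smul_le hb hr.le t hle
    _ ≤ ε / (M + 1) * M := by gcongr; exact hM t
    _ < ε / (M + 1) * (M + 1) := by gcongr; linarith
    _ = ε := by field_simp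

/-- A series over a disjoint positive family is nonnegative only if its coefficients are: a
negative coefficient would place a positive multiple of its basis vector below the sum of the
other terms, from which that vector is disjoint. -/
lemma nonneg_of_hasSum_smul_nonneg {ι : Type*} {b : ι → E} (hb : ∀ i, 0 < b i)
    (hd : Pairwise fun i j => b i ⊓ b j = 0) {c : ι → ℝ} {x : E}
    (hx : HasSum (fun i => c i • b i) x) (h0 : 0 ≤ x) (n : ι) : 0 ≤ c n := by
  classical
  by_contra! hn
  have hR := hx.update n 0
  set R : E := 0 - c n • b n + x with hRdef
  have hle : (-c n) • b n ≤ R := by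
    rw [hRdef, zero_sub, neg_smul]
    exact le_add_of_nonneg_right h0
  have hdis : b n ⊓ R ≤ 0 := by
    refine le_of_tendsto' (tendsto_const_nhds.inf_nhds hR) fun s => ?_
    have hz : b n ⊓ ∑ i ∈ s, (if i = n then 0 else |c i| • b i) = 0 := by
      refine inf_sum_eq_zero (hb n).le (fun i _ => ?_) fun i _ => ?_
      · split_ifs
        · exact le_rfl
        · exact smul_nonneg (abs_nonneg _) (hb i).le
      · split_ifs with hi
        · exact inf_eq_right.2 (hb n).le
        · exact inf_smul_eq_zero (hb i).le (hb n).le (hd (Ne.symm hi)) (abs_nonneg _)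
    refine (inf_le_inf_left _ (Finset.sum_le_sum fun i _ => ?_)).trans_eq hz
    rcases eq_or_ne i n with rfl | hi
    · simp
    · simpa [hi] using smul_le_smul_of_nonneg_right (le_abs_self (c i)) (hb i).le
  have hpos : 0 < min (-c n) 1 := lt_min (neg_pos.2 hn) one_pos
  have h1 : min (-c n) 1 • b n ≤ 0 := by
    refine (le_inf ?_ ?_).trans hdis
    · simpa using smul_le_smul_of_nonneg_right (min_le_right (-c n) 1) (hb n).le
    · exact (smul_le_smul_of_nonneg_right (min_le_left _ _) (hb n).le).trans hle
  exact smul_ne_zero hpos.ne' (hb n).ne' (h1.antisymm (smul_nonneg hpos.le (hb n).le))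

/-- The Archimedean property of a Banach lattice makes an element comparable with all positive
multiples of `a` a multiple of `a`. -/
lemma exists_eq_smul_of_comparable {a x : E} (ha : 0 < a) (hx : 0 ≤ x)
    (h : ∀ t : ℝ, 0 ≤ t → t • a ≤ x ∨ x ≤ t • a) : ∃ t : ℝ, 0 ≤ t ∧ x = t • a := by
  have hcont : Continuous fun t : ℝ => t • a := by fun_prop
  have key := isPreconnected_closed_iff.1 (isPreconnected_Ici (a := (0 : ℝ)))
    {t | t • a ≤ x} {t | x ≤ t • a} (isClosed_le hcont continuous_const)
    (isClosed_le continuous_const hcont) (fun t ht => h t ht) ⟨0, by simp, by simpa using hx⟩ ?_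
  · obtain ⟨t, ht, h1, h2⟩ := key
    exact ⟨t, ht, le_antisymm h2 h1⟩
  · have hna : 0 < ‖a‖ := norm_pos_iff.2 ha.ne'
    have ht : 0 ≤ (‖x‖ + 1) / ‖a‖ := by positivity
    refine ⟨(‖x‖ + 1) / ‖a‖, ht, (h _ ht).resolve_left fun hle => ?_⟩
    have := norm_le_norm_of_nonneg_of_le (smul_nonneg ht ha.le) hle
    rw [norm_smul, Real.norm_of_nonneg ht, div_mul_cancel₀ _ hna.ne'] at this
    linarith

end Banach

/-! ### Order isomorphisms onto `c₀` -/

section LinearOrderIso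

variable {E F : Type*} [AddCommGroup E] [Module ℝ E] [Lattice E]
    [AddCommGroup F] [Module ℝ F] [Lattice F]

lemma latticeIsomorphic_of_linearEquiv_le_iff (S : F ≃ₗ[ℝ] E) (hS : ∀ c d, S c ≤ S d ↔ c ≤ d) :
    LatticeIsomorphic E F := by
  let O : E ≃o F := OrderIso.symm ⟨S.toEquiv, hS _ _⟩
  refine ⟨S.symm, fun x => ?_⟩
  have h : S.symm (x ⊔ -x) = S.symm x ⊔ S.symm (-x) := O.map_sup x (-x)
  rw [abs, h, map_neg]
  rfl

lemma LatticeIsomorphic.orderIsomorphic [IsOrderedAddMonoid E] [IsOrderedAddMonoid F]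
    (h : LatticeIsomorphic E F) : OrderIsomorphic E F := by
  obtain ⟨T, hT⟩ := h
  refine ⟨⟨T.toEquiv, fun {x y} => ?_⟩⟩
  have key : ∀ z, 0 ≤ T z ↔ 0 ≤ z := fun z => by
    refine ⟨fun hz => ?_, fun hz => ?_⟩
    · have hz' : |z| = z := T.injective ((hT z).trans (abs_of_nonneg hz))
      exact hz' ▸ abs_nonneg z
    · rw [← abs_of_nonneg hz, hT]
      exact abs_nonneg _
  simpa using key (y - x)

end LinearOrderIso

variable {E : Type*} [Lattice E]

/-- The vector of `E` that a not necessarily linear order isomorphism `T : E ≃o c₀` sends to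
`δ` times the `n`-th unit vector. -/
def unitPreimage (T : E ≃o c0) (δ : ℝ) (n : ℕ) : E := T.symm (δ • c0Unit n)

section

variable {T : E ≃o c0}

lemma map_unitPreimage (T : E ≃o c0) (δ : ℝ) (n : ℕ) : T (unitPreimage T δ n) = δ • c0Unit n :=
  T.apply_symm_apply _

lemma unitPreimage_le_iff (δ : ℝ) (n : ℕ) (x : E) :
    unitPreimage T δ n ≤ x ↔ δ • c0Unit n ≤ T x :=
  T.symm_apply_le

variable [NormedAddCommGroup E]

lemma nonneg_map_iff (hT : T 0 = 0) {x : E} : 0 ≤ T x ↔ 0 ≤ x := by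
  rw [← hT, T.le_iff_le]

lemma unitPreimage_nonneg (hT : T 0 = 0) {δ : ℝ} (hδ : 0 ≤ δ) (n : ℕ) :
    0 ≤ unitPreimage T δ n := by
  rw [← nonneg_map_iff hT, map_unitPreimage]
  exact smul_nonneg hδ (c0Unit_nonneg n)

lemma unitPreimage_pos (hT : T 0 = 0) {δ : ℝ} (hδ : 0 < δ) (n : ℕ) :
    0 < unitPreimage T δ n := by
  refine (unitPreimage_nonneg hT hδ.le n).lt_of_ne fun h => hδ.ne' ?_
  have := map_unitPreimage T δ n
  rw [← h, hT] at this
  simpa [c0Unit_apply_self] using (congrArg (fun f : c0 => f n) this).symm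

lemma unitPreimage_inf_eq_zero (hT : T 0 = 0) {δ δ' : ℝ} (hδ : 0 ≤ δ) (hδ' : 0 ≤ δ') {n m : ℕ}
    (h : n ≠ m) : unitPreimage T δ n ⊓ unitPreimage T δ' m = 0 := by
  apply T.injective
  rw [T.map_inf, map_unitPreimage, map_unitPreimage, hT]
  ext k
  rw [c0_inf_apply]
  rcases eq_or_ne k n with rfl | hk
  · simpa [c0Unit_apply_ne h, c0Unit_apply_self] using hδ
  · have := mul_nonneg hδ' (c0Unit_nonneg m k)
    simpa [c0Unit_apply_ne hk] using this

variable [IsOrderedAddMonoid E]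

lemma sum_unitPreimage_le_iff (hT : T 0 = 0) {δ : ℕ → ℝ} (hδ : ∀ n, 0 ≤ δ n) (s : Finset ℕ) {x : E}
    (hx : 0 ≤ x) : ∑ n ∈ s, unitPreimage T (δ n) n ≤ x ↔ ∀ n ∈ s, δ n ≤ T x n := by
  rw [sum_le_iff_of_disjoint (fun n _ => unitPreimage_nonneg hT (hδ n) n)
    (fun n _ m _ h => unitPreimage_inf_eq_zero hT (hδ n) (hδ m) h) hx]
  refine forall₂_congr fun n _ => ?_
  rw [unitPreimage_le_iff, smul_c0Unit_le_iff ((nonneg_map_iff hT).2 hx)]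

/-- At some level `δ`, the preimages of `δ` times the unit vectors have bounded finite sums.
Otherwise, at each level `2⁻ᵏ` there is a finite set `sₖ` over which the sum has norm above `k`; all
these sums lie below the preimage of the single null sequence `∑ 2⁻ᵏ χ_{sₖ}`. -/
lemma exists_norm_sum_unitPreimage_le [HasSolidNorm E] (hT : T 0 = 0) :
    ∃ δ : ℝ, 0 < δ ∧ ∃ M : ℝ, ∀ s : Finset ℕ, ‖∑ n ∈ s, unitPreimage T δ n‖ ≤ M := by
  by_contra! h
  choose s hs using fun k : ℕ => h ((1 / 2 : ℝ) ^ k) (by positivity) k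
  let χ : ℕ → c0 := fun k => ∑ n ∈ s k, c0Unit n
  have hχ_one : ∀ k, ∀ n ∈ s k, χ k n = 1 := fun k n hn => by
    rw [c0_sum_apply, Finset.sum_eq_single_of_mem n hn fun m _ hm => c0Unit_apply_ne hm.symm,
      c0Unit_apply_self]
  have hχ_zero : ∀ k, ∀ n ∉ s k, χ k n = 0 := fun k n hn => by
    rw [c0_sum_apply]
    exact Finset.sum_eq_zero fun m hm => c0Unit_apply_ne (by rintro rfl; exact hn hm)
  have hχ_norm : ∀ k, ‖χ k‖ ≤ 1 := fun k => (c0_norm_le_iff zero_le_one).2 fun n => by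
    by_cases hn : n ∈ s k
    · simp [hχ_one k n hn]
    · simp [hχ_zero k n hn]
  have hχ_nonneg : ∀ k, 0 ≤ (1 / 2 : ℝ) ^ k • χ k := fun k =>
    smul_nonneg (by positivity) (Finset.sum_nonneg fun n _ => c0Unit_nonneg n)
  have hsum : Summable fun k => (1 / 2 : ℝ) ^ k • χ k := by
    refine Summable.of_norm_bounded summable_geometric_two fun k => ?_
    rw [norm_smul, Real.norm_of_nonneg (by positivity)]
    exact mul_le_of_le_one_right (by positivity) (hχ_norm k)
  set z : c0 := ∑' k, (1 / 2 : ℝ) ^ k • χ k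
  have hz : 0 ≤ T.symm z := by
    rw [← nonneg_map_iff hT, T.apply_symm_apply]
    exact tsum_nonneg hχ_nonneg
  obtain ⟨k, hk⟩ := exists_nat_gt ‖T.symm z‖
  refine (hk.trans (hs k)).not_ge (norm_le_norm_of_nonneg_of_le
    (Finset.sum_nonneg fun n _ => unitPreimage_nonneg hT (by positivity) n) ?_)
  rw [sum_unitPreimage_le_iff hT (fun _ => by positivity) _ hz, T.apply_symm_apply]
  intro n hn
  have := hsum.le_tsum k (fun j _ => hχ_nonneg j) n
  rwa [ZeroAtInftyContinuousMap.smul_apply, hχ_one k n hn, smul_eq_mul, mul_one] at this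

variable [NormedSpace ℝ E] [IsOrderedModule ℝ E] [HasSolidNorm E]

/-- The order isomorphism maps rays spanned by preimages of unit vectors onto rays spanned by unit
vectors: both are chains cut out by disjointness relations. -/
lemma exists_eq_smul_unitPreimage (hT : T 0 = 0) {δ : ℝ} (hδ : 0 < δ) {n : ℕ} {x : E} (hx : 0 ≤ x)
    (h : ∀ m, m ≠ n → T x m = 0) : ∃ t : ℝ, 0 ≤ t ∧ x = t • unitPreimage T δ n := by
  refine exists_eq_smul_of_comparable (unitPreimage_pos hT hδ n) hx fun t ht => ?_
  have hy : ∀ m, m ≠ n → T (t • unitPreimage T δ n) m = 0 := fun m hm => by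
    have h0 := inf_smul_eq_zero (unitPreimage_nonneg hT hδ.le n) (unitPreimage_nonneg hT hδ.le m)
      (unitPreimage_inf_eq_zero hT hδ.le hδ.le hm) ht
    have h1 : 0 ≤ T (t • unitPreimage T δ n) m :=
      (nonneg_map_iff hT).2 (smul_nonneg ht (unitPreimage_nonneg hT hδ.le n)) m
    have h2 := congrArg (fun y => T y m) h0
    simp only [T.map_inf, map_unitPreimage, hT, c0_inf_apply] at h2
    rw [ZeroAtInftyContinuousMap.smul_apply, c0Unit_apply_self, smul_eq_mul, mul_one,
      ZeroAtInftyContinuousMap.zero_apply] at h2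
    rcases min_choice δ (T (t • unitPreimage T δ n) m) with h3 | h3
    · exact absurd (h3.symm.trans h2) hδ.ne'
    · exact h3.symm.trans h2
  rw [← T.le_iff_le, ← T.le_iff_le, eq_smul_c0Unit h, eq_smul_c0Unit hy]
  rcases le_total (T (t • unitPreimage T δ n) n) (T x n) with hle | hle
  · exact Or.inl (smul_le_smul_of_nonneg_right hle (c0Unit_nonneg n))
  · exact Or.inr (smul_le_smul_of_nonneg_right hle (c0Unit_nonneg n))

/-- Every positive vector is the sum of its components along the preimages of the unit vectors,
with coefficients tending to zero. If infinitely many coefficients were at least `ε`, then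
the null sequence `T (ε⁻¹ x)` would be at least `δ` at infinitely many places. -/
lemma exists_hasSum_unitPreimage [CompleteSpace E] (hT : T 0 = 0) {δ M : ℝ} (hδ : 0 < δ)
    (hM : ∀ s : Finset ℕ, ‖∑ n ∈ s, unitPreimage T δ n‖ ≤ M) {x : E} (hx : 0 ≤ x) :
    ∃ c : c0, 0 ≤ c ∧ HasSum (fun n => c n • unitPreimage T δ n) x := by
  have hTx : 0 ≤ T x := (nonneg_map_iff hT).2 hx
  have hray : ∀ n, ∃ t : ℝ, 0 ≤ t ∧ unitPreimage T (T x n) n = t • unitPreimage T δ n := fun n =>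
    exists_eq_smul_unitPreimage hT hδ (unitPreimage_nonneg hT (hTx n) n) fun m hm => by
      simp [map_unitPreimage, c0Unit_apply_ne hm]
  choose t ht0 ht using hray
  have hle : ∀ n, t n • unitPreimage T δ n ≤ x := fun n => by
    rw [← ht, unitPreimage_le_iff, smul_c0Unit_le_iff hTx]
  have hlim : Tendsto t cofinite (𝓝 0) := by
    refine tendsto_order.2 ⟨fun a ha => .of_forall fun n => ha.trans_le (ht0 n), fun ε hε => ?_⟩
    filter_upwards [(c0_tendsto (T (ε⁻¹ • x))).eventually_lt_const hδ] with n hn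
    by_contra! hεn
    refine hn.not_ge ?_
    have hεx : 0 ≤ ε⁻¹ • x := smul_nonneg (inv_nonneg.2 hε.le) hx
    rw [← smul_c0Unit_le_iff ((nonneg_map_iff hT).2 hεx), ← unitPreimage_le_iff]
    calc unitPreimage T δ n = ε⁻¹ • ε • unitPreimage T δ n := by rw [inv_smul_smul₀ hε.ne']
      _ ≤ ε⁻¹ • x := smul_le_smul_of_nonneg_left
          ((smul_le_smul_of_nonneg_right hεn (unitPreimage_nonneg hT hδ.le n)).trans (hle n))
          (inv_nonneg.2 hε.le)
  refine ⟨c0Mk t hlim, ht0, ?_⟩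
  have hnonneg : ∀ n, 0 ≤ t n • unitPreimage T δ n := fun n =>
    smul_nonneg (ht0 n) (unitPreimage_nonneg hT hδ.le n)
  have hsum : Summable fun n => t n • unitPreimage T δ n :=
    summable_smul_of_norm_sum_le (fun n => unitPreimage_nonneg hT hδ.le n) hM hlim
  have hx_eq : ∑' n, t n • unitPreimage T δ n = x := by
    refine le_antisymm (hsum.tsum_le_of_sum_le fun s => ?_) ?_
    · simp only [← ht]
      exact (sum_unitPreimage_le_iff hT hTx s hx).2 fun n _ => le_rfl
    · rw [← T.le_iff_le]
      intro n
      rw [← smul_c0Unit_le_iff ((nonneg_map_iff hT).2 (tsum_nonneg hnonneg)),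
        ← unitPreimage_le_iff, ht]
      exact hsum.le_tsum n fun m _ => hnonneg m
  exact hx_eq ▸ hsum.hasSum

theorem latticeIsomorphic_c0_of_orderIso [CompleteSpace E] (hT : T 0 = 0) :
    LatticeIsomorphic E c0 := by
  obtain ⟨δ, hδ, M, hM⟩ := exists_norm_sum_unitPreimage_le hT
  have hsum : ∀ c : c0, Summable fun n => c n • unitPreimage T δ n := fun c =>
    summable_smul_of_norm_sum_le (fun n => unitPreimage_nonneg hT hδ.le n) hM (c0_tendsto c)
  let S : c0 →ₗ[ℝ] E :=
    { toFun := fun c => ∑' n, c n • unitPreimage T δ n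
      map_add' := fun c d => by
        simp only [ZeroAtInftyContinuousMap.add_apply, add_smul]
        exact (hsum c).tsum_add (hsum d)
      map_smul' := fun r c => by
        simp only [ZeroAtInftyContinuousMap.smul_apply, smul_assoc]
        exact (hsum c).tsum_const_smul r }
  have hS : ∀ c, 0 ≤ S c ↔ 0 ≤ c := fun c =>
    ⟨fun h => nonneg_of_hasSum_smul_nonneg (fun n => unitPreimage_pos hT hδ n)
      (fun n m hnm => unitPreimage_inf_eq_zero hT hδ.le hδ.le hnm) (hsum c).hasSum h,
      fun h => tsum_nonneg fun n => smul_nonneg (h n) (unitPreimage_nonneg hT hδ.le n)⟩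
  have hle : ∀ c d, S c ≤ S d ↔ c ≤ d := fun c d => by
    rw [← sub_nonneg, ← map_sub, hS, sub_nonneg]
  have hinj : Function.Injective S := fun c d h =>
    le_antisymm ((hle c d).1 h.le) ((hle d c).1 h.ge)
  have hsurj_nonneg : ∀ x, 0 ≤ x → ∃ c, S c = x := fun x hx =>
    let ⟨c, _, hc⟩ := exists_hasSum_unitPreimage hT hδ hM hx
    ⟨c, hc.tsum_eq⟩
  have hsurj : Function.Surjective S := fun x => by
    obtain ⟨c, hc⟩ := hsurj_nonneg x⁺ (posPart_nonneg x)
    obtain ⟨d, hd⟩ := hsurj_nonneg x⁻ (negPart_nonneg x)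
    exact ⟨c - d, by rw [map_sub, hc, hd, posPart_sub_negPart]⟩
  exact latticeIsomorphic_of_linearEquiv_le_iff (LinearEquiv.ofBijective S ⟨hinj, hsurj⟩) hle

theorem OrderIsomorphic.latticeIsomorphic_c0 [CompleteSpace E] (h : OrderIsomorphic E c0) :
    LatticeIsomorphic E c0 := by
  obtain ⟨T⟩ := h
  refine latticeIsomorphic_c0_of_orderIso (T := T.trans (OrderIso.subRight (T 0))) ?_
  simp

end

/-! ### Closed sublattices of `c₀` -/

variable {F : Submodule ℝ c0}

lemma IsClosedSublattice.abs_mem (hF : IsClosedSublattice F) {f : c0} (hf : f ∈ F) : |f| ∈ F :=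
  hF.1.supClosed hf (F.neg_mem hf)

/-- `h` is the least positive element of `F` with value `1` at the coordinate `k`; equivalently,
each positive `f` in `F` dominates the multiple of `h` that agrees with it at `k`. -/
structure IsAtomAt (F : Submodule ℝ c0) (k : ℕ) (h : c0) : Prop where
  mem : h ∈ F
  nonneg : 0 ≤ h
  apply_self : h k = 1
  smul_le : ∀ f ∈ F, 0 ≤ f → f k • h ≤ f

/-- The pointwise infimum of all positive elements of `F` with value `1` at `k` is again in `F`:
these elements are directed downwards and vanish at infinity, so they approach their infimum
uniformly. -/
lemma IsClosedSublattice.exists_isAtomAt (hF : IsClosedSublattice F) {k : ℕ} {f : c0} (hf : f ∈ F)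
    (hk : f k ≠ 0) : ∃ h, IsAtomAt F k h := by
  let D : Set c0 := {g | g ∈ F ∧ 0 ≤ g ∧ g k = 1}
  have hnormalize : ∀ g ∈ F, 0 ≤ g → g k ≠ 0 → (g k)⁻¹ • g ∈ D := fun g hg h0 hgk =>
    ⟨F.smul_mem _ hg, smul_nonneg (inv_nonneg.2 (h0 k)) h0, inv_mul_cancel₀ hgk⟩
  obtain ⟨g₀, hg₀⟩ : D.Nonempty :=
    ⟨_, hnormalize |f| (hF.abs_mem hf) (abs_nonneg f) (abs_ne_zero.2 hk)⟩
  have : Nonempty D := ⟨⟨g₀, hg₀⟩⟩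
  let u : ℕ → ℝ := fun l => ⨅ g : D, (g : c0) l
  have hbdd : ∀ l, BddBelow (Set.range fun g : D => (g : c0) l) := fun l =>
    ⟨0, by rintro _ ⟨g, rfl⟩; exact g.2.2.1 l⟩
  have hu_le : ∀ g ∈ D, ∀ l, u l ≤ g l := fun g hg l => ciInf_le (hbdd l) ⟨g, hg⟩
  have hu_nonneg : ∀ l, 0 ≤ u l := fun l => le_ciInf fun g => g.2.2.1 l
  have hu : Tendsto u cofinite (𝓝 0) :=
    tendsto_of_tendsto_of_tendsto_of_le_of_le tendsto_const_nhds (c0_tendsto g₀) hu_nonneg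
      (hu_le g₀ hg₀)
  refine ⟨c0Mk u hu, ?_, hu_nonneg, ?_, fun g hg h0 l => ?_⟩
  · rw [← SetLike.mem_coe, ← hF.2.closure_eq, Metric.mem_closure_iff]
    intro ε hε
    have happrox : ∀ s : Finset ℕ, ∃ g ∈ D, g ≤ g₀ ∧ ∀ l ∈ s, g l ≤ u l + ε / 2 := by
      intro s
      induction s using Finset.induction_on with
      | empty => exact ⟨g₀, hg₀, le_rfl, by simp⟩
      | insert a s _ ih =>
        obtain ⟨g, hg, hgg₀, hgs⟩ := ih
        obtain ⟨⟨g', hg'⟩, hg'a⟩ := exists_lt_of_ciInf_lt (show u a < u a + ε / 2 by linarith)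
        refine ⟨g ⊓ g', ⟨hF.1.infClosed hg.1 hg'.1, le_inf hg.2.1 hg'.2.1, ?_⟩,
          inf_le_left.trans hgg₀, fun l hl => ?_⟩
        · rw [c0_inf_apply, hg.2.2, hg'.2.2, inf_idem]
        · rcases Finset.mem_insert.1 hl with rfl | hl
          · exact inf_le_right.trans hg'a.le
          · exact inf_le_left.trans (hgs l hl)
    have hfin : {l | ¬ g₀ l ≤ ε / 2}.Finite :=
      (c0_tendsto g₀).eventually_le_const (half_pos hε)
    obtain ⟨g, hg, hgg₀, hgs⟩ := happrox hfin.toFinset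
    refine ⟨g, hg.1, ?_⟩
    rw [dist_comm, dist_eq_norm]
    refine lt_of_le_of_lt ((c0_norm_le_iff (half_pos hε).le).2 fun l => ?_) (half_lt_self hε)
    change |g l - u l| ≤ ε / 2
    rw [abs_of_nonneg (sub_nonneg.2 (hu_le g hg l))]
    by_cases hl : g₀ l ≤ ε / 2
    · linarith [hgg₀ l, hu_nonneg l]
    · linarith [hgs l (hfin.mem_toFinset.2 hl)]
  · exact (iInf_congr fun g : D => g.2.2.2).trans ciInf_const
  · change g k * u l ≤ g l
    rcases (h0 k).eq_or_lt with hgk | hgk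
    · rw [← hgk, ZeroAtInftyContinuousMap.zero_apply, zero_mul]
      exact h0 l
    · have := hu_le _ (hnormalize g hg h0 hgk.ne') l
      calc g k * u l ≤ g k * ((g k)⁻¹ * g l) := mul_le_mul_of_nonneg_left this hgk.le
        _ = g l := mul_inv_cancel_left₀ hgk.ne' _

/-- On the support of an atom, all elements of `F` are proportional to it. -/
lemma IsAtomAt.apply_eq (hF : IsClosedSublattice F) {k : ℕ} {h : c0} (hh : IsAtomAt F k h) {l : ℕ}
    (hl : 0 < h l) {f : c0} (hf : f ∈ F) : f l = f k * h l := by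
  have hvanish : ∀ g ∈ F, 0 ≤ g → g k = 0 → g l = 0 := fun g hg h0 hgk => by
    -- Subtracting `h ⊓ g` from `h` would give a smaller element with value `1` at `k`.
    have hk : (h - h ⊓ g) k = 1 := by
      rw [ZeroAtInftyContinuousMap.sub_apply, c0_inf_apply, hgk, hh.apply_self,
        min_eq_right zero_le_one, sub_zero]
    have h1 := hh.smul_le (h - h ⊓ g) (F.sub_mem hh.mem (hF.1.infClosed hh.mem hg))
      (sub_nonneg.2 inf_le_left)
    rw [hk, one_smul] at h1
    have h2 : h l ≤ h l - h l ⊓ g l := h1 l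
    have h3 : h l ⊓ g l ≤ 0 := by linarith
    exact le_antisymm ((min_le_iff.1 h3).resolve_left hl.not_ge) (h0 l)
  have hpos : ∀ g ∈ F, 0 ≤ g → g l = g k * h l := fun g hg h0 => by
    have := hvanish (g - g k • h) (F.sub_mem hg (F.smul_mem _ hh.mem))
      (sub_nonneg.2 (hh.smul_le g hg h0)) (by simp [hh.apply_self])
    simpa [sub_eq_zero] using this
  have h1 := hpos |f| (hF.abs_mem hf) (abs_nonneg f)
  have h2 := hpos (|f| - f) (F.sub_mem (hF.abs_mem hf) hf) (sub_nonneg.2 (le_abs_self f))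
  simp only [ZeroAtInftyContinuousMap.sub_apply, sub_mul] at h2
  linarith

/-- A normalised atom of `F`: it attains its maximum `1` at `k`, and at no earlier coordinate.
Each atom has exactly one positive multiple of this form, for exactly one `k`. -/
structure IsLeadingAtom (F : Submodule ℝ c0) (k : ℕ) (h : c0) : Prop extends IsAtomAt F k h where
  le_one : ∀ j, h j ≤ 1
  lt_one : ∀ j < k, h j < 1

lemma IsClosedSublattice.exists_isLeadingAtom (hF : IsClosedSublattice F) {l : ℕ} {f : c0}
    (hf : f ∈ F) (hl : f l ≠ 0) : ∃ k h, IsLeadingAtom F k h ∧ 0 < h l := by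
  obtain ⟨g, hg⟩ := hF.exists_isAtomAt hf hl
  have hmax : ∃ j, ∀ i, g i ≤ g j :=
    (map_continuous g).exists_forall_ge' l <| (zero_at_infty g).eventually_le_const <| by
      rw [hg.apply_self]
      exact one_pos
  classical
  set k := Nat.find hmax
  have hk : ∀ i, g i ≤ g k := Nat.find_spec hmax
  have hk_lt : ∀ j < k, g j < g k := fun j hj => by
    by_contra! hle
    exact Nat.find_min hmax hj fun i => (hk i).trans hle
  have hgk : 0 < g k := (zero_lt_one.trans_eq hg.apply_self.symm).trans_le (hk l)
  refine ⟨k, (g k)⁻¹ • g, ⟨⟨F.smul_mem _ hg.mem, smul_nonneg (inv_nonneg.2 hgk.le) hg.nonneg,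
    inv_mul_cancel₀ hgk.ne', fun f hf h0 => ?_⟩, fun j => ?_, fun j hj => ?_⟩, ?_⟩
  · rw [hg.apply_eq hF hgk hf, smul_smul, mul_assoc, mul_inv_cancel₀ hgk.ne', mul_one]
    exact hg.smul_le f hf h0
  · exact (inv_mul_le_one₀ hgk).2 (hk j)
  · exact (inv_mul_lt_one₀ hgk).2 (hk_lt j hj)
  · change 0 < (g k)⁻¹ * g l
    rw [hg.apply_self]
    positivity

lemma IsLeadingAtom.apply_eq_zero (hF : IsClosedSublattice F) {k k' : ℕ} {h h' : c0}
    (hh : IsLeadingAtom F k h) (hh' : IsLeadingAtom F k' h') (hne : k ≠ k') : h k' = 0 := by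
  by_contra h0
  have hpos : 0 < h k' := (hh.nonneg k').lt_of_ne (Ne.symm h0)
  have h1 := hh.apply_eq hF hpos hh'.mem
  rw [hh'.apply_self] at h1
  rcases hne.lt_or_gt with hlt | hlt
  · nlinarith [hh.le_one k', hh'.lt_one k hlt, hh'.nonneg k]
  · nlinarith [hh.lt_one k' hlt, hh'.le_one k, hh'.nonneg k]

/-- An infinite-dimensional closed sublattice `F` of `c₀` is order isomorphic to `c₀`: its
normalised atoms `hₖ` are disjoint, each element of `F` is determined by its values at the
coordinates `k`, and each null sequence of such values is realised by a series over the `hₖ`. -/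
theorem IsClosedSublattice.orderIsomorphic_c0 (hF : IsClosedSublattice F)
    (hdim : ¬ FiniteDimensional ℝ F) : OrderIsomorphic F c0 := by
  let R : Set ℕ := {k | ∃ h, IsLeadingAtom F k h}
  have hdet : ∀ f ∈ F, ∀ g ∈ F, (∀ k ∈ R, f k ≤ g k) → f ≤ g := fun f hf g hg hfg l => by
    by_cases hl : f l = 0 ∧ g l = 0
    · rw [hl.1, hl.2]
    · obtain ⟨k, h, hh, hhl⟩ : ∃ k h, IsLeadingAtom F k h ∧ 0 < h l := by
        by_cases hfl : f l = 0
        · exact hF.exists_isLeadingAtom hg fun hgl => hl ⟨hfl, hgl⟩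
        · exact hF.exists_isLeadingAtom hf hfl
      rw [hh.apply_eq hF hhl hf, hh.apply_eq hF hhl hg]
      exact mul_le_mul_of_nonneg_right (hfg k ⟨h, hh⟩) hhl.le
  have : Infinite R := by
    by_contra hfin
    rw [not_infinite_iff_finite] at hfin
    refine hdim (FiniteDimensional.of_injective
      (LinearMap.pi fun k : R => (c0Eval k).comp F.subtype) fun f g hfg => ?_)
    have hval : ∀ k ∈ R, (f : c0) k = (g : c0) k := fun k hk => congrFun hfg ⟨k, hk⟩
    exact Subtype.ext (le_antisymm (hdet f f.2 g g.2 fun k hk => (hval k hk).le)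
      (hdet g g.2 f f.2 fun k hk => (hval k hk).ge))
  obtain ⟨φ⟩ : Nonempty (ℕ ≃ R) := nonempty_equiv_of_countable
  choose h hh using fun n => (φ n).2
  have hφ : Function.Injective fun n => (φ n : ℕ) := Subtype.val_injective.comp φ.injective
  have hoff : ∀ n m, n ≠ m → h n (φ m) = 0 := fun n m hnm =>
    (hh n).apply_eq_zero hF (hh m) fun he => hnm (hφ he)
  have hnonneg : ∀ n, 0 ≤ h n := fun n => (hh n).nonneg
  have hdisj : ∀ l n m, n ≠ m → h n l ⊓ h m l = 0 := fun l n m hnm => by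
    rcases (hnonneg m l).eq_or_lt with h0 | hpos
    · rw [← h0]
      exact inf_eq_right.2 (hnonneg n l)
    · rw [(hh m).apply_eq hF hpos (hh n).mem, hoff n m hnm, zero_mul]
      exact inf_eq_left.2 hpos.le
  have hbound : ∀ s : Finset ℕ, ‖∑ n ∈ s, h n‖ ≤ 1 := fun s => by
    rw [c0_norm_le_iff zero_le_one]
    intro l
    rw [c0_sum_apply, abs_of_nonneg (Finset.sum_nonneg fun n _ => hnonneg n l)]
    exact (sum_le_iff_of_disjoint (fun n _ => hnonneg n l) (fun n _ m _ hnm => hdisj l n m hnm)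
      zero_le_one).2 fun n _ => (hh n).le_one l
  let J : F ↪o c0 := OrderEmbedding.ofMapLEIff
    (fun f => c0Mk (fun n => (f : c0) (φ n)) ((c0_tendsto f).comp hφ.tendsto_cofinite))
    fun f g => ⟨fun hfg => hdet f f.2 g g.2 fun k hk => by
      simpa using (show ∀ n, (f : c0) (φ n) ≤ (g : c0) (φ n) from hfg) (φ.symm ⟨k, hk⟩),
      fun hfg n => hfg (φ n)⟩
  refine ⟨RelIso.ofSurjective J fun c => ?_⟩
  have hsum := (summable_smul_of_norm_sum_le hnonneg hbound (c0_tendsto c)).hasSum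
  refine ⟨⟨∑' n, c n • h n, hF.2.mem_of_tendsto hsum (.of_forall fun s =>
    F.sum_mem fun n _ => F.smul_mem _ (hh n).mem)⟩, ?_⟩
  ext m
  have h1 := hsum.map (c0Eval (φ m)) (continuous_c0_apply (φ m))
  have h2 : HasSum (⇑(c0Eval (φ m)) ∘ fun n => c n • h n) (c m) := by
    convert hasSum_single m fun n hnm => ?_ using 1
    · change c m = c m * h m (φ m)
      rw [(hh m).apply_self, mul_one]
    · change c n * h n (φ m) = 0
      rw [hoff n m hnm, mul_zero]
  exact h1.unique h2

lemma not_finiteDimensional_c0 : ¬ FiniteDimensional ℝ c0 := fun _ => by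
  have hli : LinearIndependent ℝ c0Unit := by
    rw [linearIndependent_iff']
    intro s g hg n hn
    have := congrArg (fun f : c0 => f n) hg
    simp only [c0_sum_apply, ZeroAtInftyContinuousMap.smul_apply, smul_eq_mul] at this
    rwa [Finset.sum_eq_single_of_mem n hn fun m _ hm => by rw [c0Unit_apply_ne hm.symm, mul_zero],
      c0Unit_apply_self, mul_one] at this
  exact Module.Finite.not_linearIndependent_of_infinite c0Unit hli

end BanachLattice

end

theorem theorem4 (E : Type*) [NormedAddCommGroup E] [NormedSpace ℝ E] [CompleteSpace E]
    [Lattice E] [IsOrderedAddMonoid E] [IsOrderedModule ℝ E] [HasSolidNorm E] :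
    List.TFAE
      [BanachLattice.LatticeIsomorphic E BanachLattice.c0,
        BanachLattice.OrderIsomorphic E BanachLattice.c0,
        ∃ F : Submodule ℝ BanachLattice.c0, BanachLattice.IsClosedSublattice F ∧
          ¬ FiniteDimensional ℝ F ∧ BanachLattice.OrderIsomorphic E F] := by
  tfae_have 1 → 2 := fun h => h.orderIsomorphic
  tfae_have 2 → 3 := fun ⟨T⟩ => by
    refine ⟨⊤, ⟨⟨fun _ _ _ _ => trivial, fun _ _ _ _ => trivial⟩, isClosed_univ⟩, fun h => ?_,
      ⟨T.trans ⟨Submodule.topEquiv.symm.toEquiv, Iff.rfl⟩⟩⟩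
    exact BanachLattice.not_finiteDimensional_c0 Submodule.topEquiv.finiteDimensional
  tfae_have 3 → 1 := fun ⟨F, hF, hdim, ⟨T⟩⟩ =>
    have ⟨S⟩ := hF.orderIsomorphic_c0 hdim
    BanachLattice.OrderIsomorphic.latticeIsomorphic_c0 ⟨T.trans S⟩
  tfae_finish
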